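/- There is a finite simple graph $G$ with the following two properties. (a) The edges of $G$ can be coloured with six colours without forming a monochromatic $4$-clique. (b) For every partition of the six colours into three pairs, whenever the edges of $G$ are coloured with these six colours there is a monochromatic $4$-clique or a special $4$-clique. Here two colours are called opposite if they are distinct and lie in the same pair of the partition, and a $4$-clique of $G$ is called special if there is a pair of opposite colours $c_1, c_2$ such that two independent (i.e. disjoint) edges of the clique have colour $c_1$ and the remaining four edges have colour $c_2$. Edge colourings are arbitrary (not necessarily proper) maps from the edge set to the set of six colours. -/

import Mathlib

namespace SimpleGraph

variable {V K : Type*} {G : SimpleGraph V}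

/-- `s` is a `4`-clique of `G` all of whose edges receive the same colour under the
edge colouring `C`. -/
def IsMonoFourClique (C : G.EdgeLabeling K) (s : Finset V) : Prop :=
  G.IsNClique 4 s ∧
    ∃ k : K, ∀ x ∈ s, ∀ y ∈ s, ∀ h : G.Adj x y, C.get x y h = k

/-- `s = {a, b, c, d}` is a special `4`-clique of `G` under the edge colouring `C`, where `opp`
sends each colour to its opposite: two independent edges `ab`, `cd` have some colour `k`, and the
four remaining edges have the opposite colour `opp k`. -/
def IsSpecialFourClique (opp : K → K) (C : G.EdgeLabeling K) (s : Finset V) : Prop :=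
  G.IsNClique 4 s ∧
    ∃ (a b c d : V) (hab : G.Adj a b) (hcd : G.Adj c d) (hac : G.Adj a c) (had : G.Adj a d)
      (hbc : G.Adj b c) (hbd : G.Adj b d) (k : K),
      (s : Set V) = {a, b, c, d} ∧
      C.get a b hab = k ∧ C.get c d hcd = k ∧
      C.get a c hac = opp k ∧ C.get a d had = opp k ∧
      C.get b c hbc = opp k ∧ C.get b d hbd = opp k

end SimpleGraph

open Combinatorics

/-! The goal is a graph, edge-coloured without monochromatic `4`-cliques, such that every
recolouring induces a map `φ` of colours: for all `k ≠ l` some clique has colour `φ k` on a perfect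
matching and `φ l` elsewhere. If `φ k = φ l` for some `k ≠ l`, that clique is monochromatic;
otherwise `φ` is onto, and preimages of `0` and `opp 0` give a special clique. To get `φ`, start
from `matchingCliques` on many parts. The partite construction, driven by Hales–Jewett, makes the
new colour depend only on the old colour and the two parts (`exists_mono_between_parts`). Ramsey's
theorem then removes the dependence on the parts. -/

/-- A partite system: disjoint symmetric binary relations `R k` on a finite set that is divided
into parts indexed by `I`, such that related vertices lie in different parts and no `R k`
contains a `4`-clique. -/
structure PartiteSystem (I K : Type) where
  V : Type
  finite : Finite V
  part : V → I
  R : K → V → V → Prop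
  symm : ∀ {k x y}, R k x y → R k y x
  part_ne : ∀ {k x y}, R k x y → part x ≠ part y
  unique : ∀ {k l x y}, R k x y → R l x y → k = l
  cliqueFree : ∀ k (f : Fin 4 → V), ¬ ∀ p q, p ≠ q → R k (f p) (f q)

/-! ### The partite construction along combinatorial lines. -/

namespace PartiteSystem

variable {I K : Type} (P : PartiteSystem I K) (a b : I) (i : K)

/-- The `i`-coloured edges from part `a` to part `b`. -/
abbrev EdgesBetween : Type :=
  {e : P.V × P.V // P.R i e.1 e.2 ∧ P.part e.1 = a ∧ P.part e.2 = b}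

variable {P a b i}

open Classical in
/-- The vertex that replaces `v` in a coordinate of a combinatorial line: `v` itself in an active
coordinate, and the endpoint in the part of `v` of the edge `e` in a coordinate fixed to `e`. -/
noncomputable def lineCoord (o : Option (P.EdgesBetween a b i)) (v : P.V) : P.V :=
  o.elim v fun e => if P.part v = a then e.1.1 else if P.part v = b then e.1.2 else v

open Classical in
/-- The copy of a partite system that belongs to a combinatorial line. -/
noncomputable def lineEmb {ι : Type} (L : Line (P.EdgesBetween a b i) ι) (v : P.V) :
    (ι → P.V) × Option (Line (P.EdgesBetween a b i) ι) × I :=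
  (fun t => lineCoord (L.idxFun t) v,
    -- The tag makes copies of distinct lines disjoint outside parts `a` and `b`.
    if P.part v = a ∨ P.part v = b then none else some L, P.part v)

section LineEmb

variable {ι : Type} {L L' : Line (P.EdgesBetween a b i) ι} {x x' y y' : P.V} {k : K}

lemma lineEmb_part (h : lineEmb L x = lineEmb L' x') : P.part x = P.part x' :=
  congrArg (fun u => u.2.2) h

lemma lineEmb_coord (h : lineEmb L x = lineEmb L' x') (t : ι) :
    lineCoord (L.idxFun t) x = lineCoord (L'.idxFun t) x' :=
  congrFun (congrArg Prod.fst h) t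

lemma lineEmb_injective (L : Line (P.EdgesBetween a b i) ι) :
    Function.Injective (lineEmb L) := by
  intro x y h
  obtain ⟨t, ht⟩ := L.proper
  simpa [ht, lineCoord] using lineEmb_coord h t

lemma lineEmb_line_eq (h : lineEmb L x = lineEmb L' x')
    (ha : P.part x ≠ a) (hb : P.part x ≠ b) : L = L' := by
  have hp := lineEmb_part h
  have h2 := congrArg (fun u => u.2.1) h
  simpa [lineEmb, ha, hb, ← hp] using h2

/-- At an active coordinate of `L`, either `L'` is active too and the pairs coincide, or `L'` is
fixed to an edge and `(x, y)` is that edge. By symmetry, in the remaining case both pairs have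
colour `i`, so `k = i`. -/
lemma lineEmb_reflect_of_part (hab : a ≠ b) (hx : lineEmb L x = lineEmb L' x')
    (hy : lineEmb L y = lineEmb L' y') (hxa : P.part x = a) (hyb : P.part y = b)
    (hR : P.R k x' y') : P.R k x y := by
  have hxa' := (lineEmb_part hx).symm.trans hxa
  have hyb' := (lineEmb_part hy).symm.trans hyb
  obtain ⟨t, ht⟩ := L.proper
  obtain ⟨t', ht'⟩ := L'.proper
  have hxt := lineEmb_coord hx t
  have hyt := lineEmb_coord hy t
  have hxt' := lineEmb_coord hx t'
  have hyt' := lineEmb_coord hy t'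
  cases h : L'.idxFun t with
  | none =>
    simp only [lineCoord, ht, h, Option.elim_none] at hxt hyt
    rwa [hxt, hyt]
  | some e =>
    simp only [lineCoord, ht, h, Option.elim_none, Option.elim_some, hxa', hyb', hab.symm,
      if_true, if_false] at hxt hyt
    have hi : P.R i x y := by rw [hxt, hyt]; exact e.2.1
    cases h' : L.idxFun t' with
    | none =>
      simp only [lineCoord, ht', h', Option.elim_none] at hxt' hyt'
      rwa [hxt', hyt']
    | some e' =>
      simp only [lineCoord, ht', h', Option.elim_none, Option.elim_some, hxa, hyb, hab.symm,
        if_true, if_false] at hxt' hyt'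
      have hi' : P.R i x' y' := by rw [← hxt', ← hyt']; exact e'.2.1
      rwa [P.unique hR hi']

lemma lineEmb_reflect (hx : lineEmb L x = lineEmb L' x') (hy : lineEmb L y = lineEmb L' y')
    (hR : P.R k x' y') : P.R k x y := by
  have of_eq : L = L' → P.R k x y := by
    rintro rfl
    rwa [lineEmb_injective L hx, lineEmb_injective L hy]
  by_cases hx0 : P.part x ≠ a ∧ P.part x ≠ b
  · exact of_eq (lineEmb_line_eq hx hx0.1 hx0.2)
  by_cases hy0 : P.part y ≠ a ∧ P.part y ≠ b
  · exact of_eq (lineEmb_line_eq hy hy0.1 hy0.2)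
  have hne : P.part x ≠ P.part y := by
    rw [lineEmb_part hx, lineEmb_part hy]
    exact P.part_ne hR
  have hcase : (P.part x = a ∧ P.part y = b) ∨ (P.part y = a ∧ P.part x = b) := by
    grind
  rcases hcase with ⟨hxa, hyb⟩ | ⟨hya, hxb⟩
  · exact lineEmb_reflect_of_part (by rw [← hxa, ← hyb]; exact hne) hx hy hxa hyb hR
  · exact P.symm <|
      lineEmb_reflect_of_part (by rw [← hya, ← hxb]; exact hne.symm) hy hx hya hxb (P.symm hR)

end LineEmb

lemma finite_line (α ι : Type) [Finite α] [Finite ι] : Finite (Line α ι) :=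
  Finite.of_injective Line.idxFun fun _ _ h => Line.ext h

variable (P a b i) in
/-- The union of the copies of `P` that belong to the combinatorial lines in a power of the set of
`i`-coloured edges from part `a` to part `b`. -/
def linePower [Finite I] (ι : Type) [Finite ι] : PartiteSystem I K where
  V := (ι → P.V) × Option (Line (P.EdgesBetween a b i) ι) × I
  finite := by
    have := P.finite
    have := finite_line (P.EdgesBetween a b i) ι
    infer_instance
  part u := u.2.2
  R k u w := ∃ (L : Line (P.EdgesBetween a b i) ι) (x y : P.V),
    u = lineEmb L x ∧ w = lineEmb L y ∧ P.R k x y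
  symm := fun ⟨L, x, y, hx, hy, h⟩ => ⟨L, y, x, hy, hx, P.symm h⟩
  part_ne := by
    rintro k _ _ ⟨L, x, y, rfl, rfl, h⟩
    exact P.part_ne h
  unique := by
    rintro k l _ _ ⟨L, x, y, rfl, rfl, h⟩ ⟨L', x', y', hx, hy, h'⟩
    exact P.unique h (lineEmb_reflect hx hy h')
  cliqueFree := by
    intro k f hf
    have hne : ∀ p q, p ≠ q → (f p).2.2 ≠ (f q).2.2 := by
      intro p q hpq
      obtain ⟨L, x, y, hx, hy, h⟩ := hf p q hpq
      rw [hx, hy]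
      exact P.part_ne h
    -- The clique has vertices in more than two parts; one outside `a` and `b` determines the line,
    -- so the whole clique lies in one copy of `P`.
    obtain ⟨p, hpa, hpb⟩ : ∃ p, (f p).2.2 ≠ a ∧ (f p).2.2 ≠ b := by
      have h01 := hne 0 1 (by decide)
      have h02 := hne 0 2 (by decide)
      have h12 := hne 1 2 (by decide)
      by_contra! hcon
      have h0 := or_iff_not_imp_left.2 (hcon 0)
      have h1 := or_iff_not_imp_left.2 (hcon 1)
      have h2 := or_iff_not_imp_left.2 (hcon 2)
      rcases h0 with h0 | h0 <;> rcases h1 with h1 | h1 <;> rcases h2 with h2 | h2 <;>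
        simp [h0, h1, h2] at h01 h02 h12
    obtain ⟨r, hr⟩ := exists_ne p
    obtain ⟨L, x, -, hx, -, -⟩ := hf p r hr.symm
    have hcopy : ∀ q, ∃ z, f q = lineEmb L z := by
      intro q
      by_cases hq : q = p
      · exact ⟨x, hq ▸ hx⟩
      · obtain ⟨L', x', y', hx', hy', -⟩ := hf p q (Ne.symm hq)
        have hL : L = L' := by
          refine lineEmb_line_eq (hx.symm.trans hx') ?_ ?_
          · rwa [hx] at hpa
          · rwa [hx] at hpb
        exact ⟨y', hL ▸ hy'⟩
    choose g hg using hcopy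
    refine P.cliqueFree k g fun p q hpq => ?_
    obtain ⟨L', x', y', hx', hy', h⟩ := hf p q hpq
    exact lineEmb_reflect ((hg p).symm.trans hx') ((hg q).symm.trans hy') h

/-- A map between partite systems that preserves the relations and the parts. -/
structure Hom (P Q : PartiteSystem I K) where
  toFun : P.V → Q.V
  part_eq : ∀ x, Q.part (toFun x) = P.part x
  map_rel : ∀ {k x y}, P.R k x y → Q.R k (toFun x) (toFun y)

theorem exists_mono_edgesBetween [Finite I] (κ : Type) [Finite κ] (P : PartiteSystem I K)
    (a b : I) (i : K) :
    ∃ Q : PartiteSystem I K, ∀ χ : Q.V → Q.V → κ, ∃ (f : Hom P Q) (c : κ),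
      ∀ x y, P.part x = a → P.part y = b → P.R i x y → χ (f.toFun x) (f.toFun y) = c := by
  have := P.finite
  obtain ⟨ι, _, hι⟩ := Line.exists_mono_in_high_dimension (P.EdgesBetween a b i) κ
  refine ⟨P.linePower a b i ι, fun χ => ?_⟩
  -- A word of edges is coloured by the pair formed by its word of first and its word of second
  -- endpoints.
  obtain ⟨L, c, hL⟩ := hι fun w => χ (fun t => (w t).1.1, none, a) (fun t => (w t).1.2, none, b)
  refine ⟨⟨lineEmb L, fun _ => rfl, fun {k x y} h => ⟨L, x, y, rfl, rfl, h⟩⟩, c, ?_⟩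
  intro x y hx hy h
  have hab : b ≠ a := by
    rw [← hx, ← hy]
    exact (P.part_ne h).symm
  rw [← hL ⟨(x, y), h, hx, hy⟩]
  congr 1
  · simp only [lineEmb, hx, true_or, if_true]
    refine congrArg (fun z => (z, none, a)) (funext fun t => ?_)
    cases ht : L.idxFun t <;> simp [lineCoord, ht, hx]
  · simp only [lineEmb, hy, or_true, if_true]
    refine congrArg (fun z => (z, none, b)) (funext fun t => ?_)
    cases ht : L.idxFun t <;> simp [lineCoord, ht, hy, hab]

theorem exists_mono_edgesBetween_list [Finite I] (κ : Type) [Finite κ] (P : PartiteSystem I K)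
    (l : List (I × I × K)) :
    ∃ Q : PartiteSystem I K, ∀ χ : Q.V → Q.V → κ, ∃ f : Hom P Q, ∀ s ∈ l, ∃ c : κ,
      ∀ x y, P.part x = s.1 → P.part y = s.2.1 → P.R s.2.2 x y →
        χ (f.toFun x) (f.toFun y) = c := by
  induction l with
  | nil => exact ⟨P, fun χ => ⟨⟨id, fun _ => rfl, id⟩, by simp⟩⟩
  | cons s l ih =>
    obtain ⟨Q, hQ⟩ := ih
    obtain ⟨Q', hQ'⟩ := exists_mono_edgesBetween κ Q s.1 s.2.1 s.2.2
    refine ⟨Q', fun χ => ?_⟩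
    obtain ⟨g, c, hg⟩ := hQ' χ
    obtain ⟨f, hf⟩ := hQ fun x y => χ (g.toFun x) (g.toFun y)
    refine ⟨⟨g.toFun ∘ f.toFun, fun x => (g.part_eq _).trans (f.part_eq x),
      fun h => g.map_rel (f.map_rel h)⟩, ?_⟩
    intro s' hs'
    rcases List.mem_cons.1 hs' with rfl | hs'
    · exact ⟨c, fun x y hx hy h =>
        hg _ _ ((f.part_eq x).trans hx) ((f.part_eq y).trans hy) (f.map_rel h)⟩
    · exact hf s' hs'

theorem exists_mono_between_parts [Finite I] [Finite K] (κ : Type) [Finite κ]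
    (P : PartiteSystem I K) :
    ∃ Q : PartiteSystem I K, ∀ χ : Q.V → Q.V → κ, ∃ (f : Hom P Q) (c : I → I → K → κ),
      ∀ k x y, P.R k x y → χ (f.toFun x) (f.toFun y) = c (P.part x) (P.part y) k := by
  have := Fintype.ofFinite I
  have := Fintype.ofFinite K
  obtain ⟨Q, hQ⟩ := exists_mono_edgesBetween_list κ P (Finset.univ : Finset (I × I × K)).toList
  refine ⟨Q, fun χ => ?_⟩
  obtain ⟨f, hf⟩ := hQ χ
  have hf' : ∀ (u v : I) (k : K), ∃ c : κ, ∀ x y, P.part x = u → P.part y = v → P.R k x y →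
      χ (f.toFun x) (f.toFun y) = c := fun u v k => hf (u, v, k) (by simp)
  choose c hc using hf'
  exact ⟨f, c, fun k x y h => hc _ _ k x y rfl rfl h⟩

/-- The graph of all pairs related by some relation of a partite system. -/
def graph (P : PartiteSystem I K) : SimpleGraph P.V where
  Adj x y := ∃ k, P.R k x y
  symm := ⟨fun _ _ ⟨k, h⟩ => ⟨k, P.symm h⟩⟩
  loopless := ⟨fun _ ⟨_, h⟩ => P.part_ne h rfl⟩

/-- The edge colouring of the graph of a partite system by its relations. -/
noncomputable def labeling (P : PartiteSystem I K) : P.graph.EdgeLabeling K :=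
  SimpleGraph.EdgeLabeling.mk (fun _ _ h => h.choose) fun _ _ h =>
    P.unique (P.symm h.symm.choose_spec) h.choose_spec

theorem not_isMonoFourClique_labeling (P : PartiteSystem I K) (s : Finset P.V) :
    ¬ P.graph.IsMonoFourClique P.labeling s := by
  rintro ⟨hs, k, hk⟩
  have e : Fin 4 ≃ s := (Fintype.equivFinOfCardEq (by simp [hs.card_eq])).symm
  refine P.cliqueFree k (fun p => e p) fun p q hpq => ?_
  have hadj : P.graph.Adj (e p) (e q) :=
    hs.isClique (e p).2 (e q).2 fun h => hpq (e.injective (Subtype.ext h))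
  rw [← hk _ (e p).2 _ (e q).2 hadj]
  exact hadj.choose_spec

end PartiteSystem

/-! ### The initial system of cliques. -/

/-- Whether two vertices of `Fin 4` are matched in the perfect matching `{01, 23}`. -/
def MatchedPair (p q : Fin 4) : Prop := p.val / 2 = q.val / 2

instance : DecidableRel MatchedPair := fun _ _ => inferInstanceAs (Decidable (_ = _))

lemma matchedPair_comm {p q : Fin 4} : MatchedPair p q ↔ MatchedPair q p := eq_comm

/-- On every `4`-tuple of distinct indices, and for all colours `k ≠ l`, a separate `4`-clique whose
edges have colour `k` on a perfect matching and colour `l` elsewhere. -/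
def matchingCliques (I K : Type) [Finite I] [Finite K] : PartiteSystem I K where
  V := ((Fin 4 ↪ I) × {kl : K × K // kl.1 ≠ kl.2}) × Fin 4
  finite := inferInstance
  part u := u.1.1 u.2
  R m u w := u.1 = w.1 ∧ u.2 ≠ w.2 ∧
    m = if MatchedPair u.2 w.2 then u.1.2.1.1 else u.1.2.1.2
  symm := by
    rintro m ⟨u, p⟩ ⟨_, q⟩ ⟨rfl, hpq, h⟩
    exact ⟨rfl, hpq.symm, h.trans (if_congr matchedPair_comm rfl rfl)⟩
  part_ne := by
    rintro m ⟨u, p⟩ ⟨_, q⟩ ⟨rfl, hpq, -⟩ h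
    exact hpq (u.1.injective h)
  unique := by
    rintro m m' u w ⟨-, -, h⟩ ⟨-, -, h'⟩
    exact h.trans h'.symm
  cliqueFree := by
    intro m f hf
    -- A clique of one relation would fill all four positions, hence contain both a matched and an
    -- unmatched pair.
    have hinj : Function.Injective fun p => (f p).2 := by
      intro p q h
      by_contra hpq
      exact (hf p q hpq).2.1 h
    have hsurj := Finite.surjective_of_injective hinj
    obtain ⟨p, hp⟩ := hsurj 0
    obtain ⟨q, hq⟩ := hsurj 1
    obtain ⟨r, hr⟩ := hsurj 2
    simp only at hp hq hr
    have hpq : p ≠ q := by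
      rintro rfl
      exact absurd (hp.symm.trans hq) (by decide)
    have hpr : p ≠ r := by
      rintro rfl
      exact absurd (hp.symm.trans hr) (by decide)
    have h1 := (hf p q hpq).2.2
    have h2 := (hf p r hpr).2.2
    rw [hp, hq, if_pos (by decide)] at h1
    rw [hp, hr, if_neg (by decide)] at h2
    exact (f p).1.2.2 (h1.symm.trans h2)

/-! ### Ramsey's theorem and the induced map of colours. -/

/-- Greedy choice: pick a vertex, then continue inside a large colour class around it. Each entry
records its colour towards all later ones. -/
lemma exists_list_pairwise_eq (κ : Type) [Finite κ] (n : ℕ) :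
    ∃ N : ℕ, ∀ (I : Type) (S : Finset I) (ψ : I → I → κ), N ≤ S.card →
      ∃ l : List (I × κ), l.length = n ∧ (∀ x ∈ l, x.1 ∈ S) ∧
        l.Pairwise fun x y => x.1 ≠ y.1 ∧ ψ x.1 y.1 = x.2 := by
  classical
  have := Fintype.ofFinite κ
  induction n with
  | zero => exact ⟨0, fun I S ψ _ => ⟨[], by simp⟩⟩
  | succ n ih =>
    obtain ⟨N, hN⟩ := ih
    refine ⟨Fintype.card κ * N + 1, fun I S ψ hS => ?_⟩
    obtain ⟨s, hs⟩ : S.Nonempty := Finset.card_pos.1 (by omega)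
    have hcard : Fintype.card κ * N ≤ (S.erase s).card := by
      rw [Finset.card_erase_of_mem hs]
      omega
    have : Nonempty κ := ⟨ψ s s⟩
    obtain ⟨c, -, hc⟩ := Finset.exists_le_card_fiber_of_mul_le_card_of_maps_to
      (s := S.erase s) (t := Finset.univ) (f := ψ s) (n := N)
      (fun _ _ => Finset.mem_univ _) Finset.univ_nonempty (by simpa using hcard)
    obtain ⟨l, hlen, hmem, hl⟩ := hN I _ ψ hc
    refine ⟨(s, c) :: l, by simp [hlen], ?_, ?_⟩
    · rintro x hx
      rcases List.mem_cons.1 hx with rfl | hx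
      · exact hs
      · exact Finset.mem_of_mem_erase (Finset.mem_filter.1 (hmem x hx)).1
    · refine List.pairwise_cons.2 ⟨fun x hx => ?_, hl⟩
      obtain ⟨h1, h2⟩ := Finset.mem_filter.1 (hmem x hx)
      exact ⟨(Finset.ne_of_mem_erase h1).symm, h2⟩

/-- Ramsey's theorem for pairs, with finitely many colours. -/
theorem exists_mono_tuple (κ : Type) [Finite κ] (m : ℕ) :
    ∃ N : ℕ, ∀ ψ : Fin N → Fin N → κ,
      ∃ (g : Fin m ↪ Fin N) (c : κ), ∀ p q, p < q → ψ (g p) (g q) = c := by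
  classical
  have := Fintype.ofFinite κ
  obtain ⟨N, hN⟩ := exists_list_pairwise_eq κ (Fintype.card κ * m + 1)
  refine ⟨N, fun ψ => ?_⟩
  obtain ⟨l, hlen, -, hl⟩ := hN (Fin N) Finset.univ ψ (by simp)
  have : Nonempty κ := ⟨(l[0]'(by omega)).2⟩
  obtain ⟨c, -, hc⟩ := Finset.exists_le_card_fiber_of_mul_le_card_of_maps_to
    (s := (Finset.univ : Finset (Fin l.length))) (t := Finset.univ) (f := fun j => (l.get j).2)
    (n := m) (fun _ _ => Finset.mem_univ _) Finset.univ_nonempty (by simp [hlen])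
  obtain ⟨T, hT, hTm⟩ := Finset.exists_subset_card_eq hc
  let e := T.orderEmbOfFin hTm
  have hpair : ∀ p q : Fin m, p < q → (l.get (e p)).1 ≠ (l.get (e q)).1 ∧
      ψ (l.get (e p)).1 (l.get (e q)).1 = c := by
    intro p q hpq
    have h := List.pairwise_iff_get.1 hl (e p) (e q) (e.lt_iff_lt.2 hpq)
    refine ⟨h.1, h.2.trans ?_⟩
    exact (Finset.mem_filter.1 (hT (T.orderEmbOfFin_mem hTm p))).2
  refine ⟨⟨fun p => (l.get (e p)).1, fun p q h => ?_⟩, c, fun p q hpq => (hpair p q hpq).2⟩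
  rcases lt_trichotomy p q with hpq | hpq | hpq
  · exact absurd h (hpair p q hpq).1
  · exact hpq
  · exact absurd h.symm (hpair q p hpq).1

/-- A partite system such that every colouring of the edges of its graph induces a map `φ` of
colours on some family of cliques, one for each pair of distinct colours. -/
theorem exists_partiteSystem_induced_map (K κ : Type) [Finite K] [Finite κ] [Nonempty κ] :
    ∃ (I : Type) (Q : PartiteSystem I K), ∀ C : Q.graph.EdgeLabeling κ, ∃ φ : K → κ,
      ∀ k l : K, k ≠ l → ∃ v : Fin 4 → Q.V, ∀ p q, p ≠ q → ∃ h : Q.graph.Adj (v p) (v q),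
        C.get _ _ h = φ (if MatchedPair p q then k else l) := by
  classical
  -- A pair of parts is coloured by its whole map from old to new colours.
  obtain ⟨N, hN⟩ := exists_mono_tuple (K → κ) 4
  obtain ⟨Q, hQ⟩ := (matchingCliques (Fin N) K).exists_mono_between_parts κ
  refine ⟨Fin N, Q, fun C => ?_⟩
  obtain ⟨f, c, hc⟩ := hQ fun x y =>
    -- The default for non-adjacent pairs is harmless: images of related vertices are adjacent.
    if h : Q.graph.Adj x y then C.get x y h else Classical.arbitrary κ
  obtain ⟨g, φ, hφ⟩ := hN c
  refine ⟨φ, fun k l hkl => ⟨fun p => f.toFun ((g, ⟨(k, l), hkl⟩), p), ?_⟩⟩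
  have hlt : ∀ p q, p < q → ∃ h : Q.graph.Adj (f.toFun ((g, ⟨(k, l), hkl⟩), p))
      (f.toFun ((g, ⟨(k, l), hkl⟩), q)), C.get _ _ h = φ (if MatchedPair p q then k else l) := by
    intro p q hpq
    have hR : (matchingCliques (Fin N) K).R (if MatchedPair p q then k else l)
        ((g, ⟨(k, l), hkl⟩), p) ((g, ⟨(k, l), hkl⟩), q) := ⟨rfl, hpq.ne, rfl⟩
    have hadj : Q.graph.Adj (f.toFun ((g, ⟨(k, l), hkl⟩), p))
      (f.toFun ((g, ⟨(k, l), hkl⟩), q)) := ⟨_, f.map_rel hR⟩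
    refine ⟨hadj, ?_⟩
    have h := hc _ _ _ hR
    rw [dif_pos hadj] at h
    exact h.trans (congrFun (hφ p q hpq) _)
  intro p q hpq
  rcases lt_or_gt_of_ne hpq with h | h
  · exact hlt p q h
  · obtain ⟨hadj, hcol⟩ := hlt q p h
    refine ⟨hadj.symm, ?_⟩
    rw [SimpleGraph.EdgeLabeling.get_comm, hcol]
    exact congrArg φ (if_congr matchedPair_comm rfl rfl)

namespace SimpleGraph

variable {V : Type} {G : SimpleGraph V} {v : Fin 4 → V}

lemma isNClique_four_image [DecidableEq V] (hv : ∀ p q, p ≠ q → G.Adj (v p) (v q)) :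
    G.IsNClique 4 (Finset.univ.image v) := by
  constructor
  · intro x hx y hy hxy
    simp only [Finset.coe_image, Finset.coe_univ, Set.image_univ] at hx hy
    obtain ⟨p, rfl⟩ := hx
    obtain ⟨q, rfl⟩ := hy
    exact hv p q fun h => hxy (h ▸ rfl)
  · rw [Finset.card_image_of_injective, Finset.card_univ, Fintype.card_fin]
    intro p q h
    by_contra hpq
    exact (hv p q hpq).ne h

lemma isMonoFourClique_image [DecidableEq V] {K : Type} {C : G.EdgeLabeling K} {k : K}
    (hv : ∀ p q, p ≠ q → ∃ h : G.Adj (v p) (v q), C.get _ _ h = k) :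
    G.IsMonoFourClique C (Finset.univ.image v) := by
  refine ⟨isNClique_four_image fun p q hpq => (hv p q hpq).1, k, fun x hx y hy h => ?_⟩
  obtain ⟨p, -, rfl⟩ := Finset.mem_image.1 hx
  obtain ⟨q, -, rfl⟩ := Finset.mem_image.1 hy
  exact (hv p q fun hpq => h.ne (hpq ▸ rfl)).2

lemma isSpecialFourClique_image [DecidableEq V] {K : Type} {opp : K → K} {C : G.EdgeLabeling K}
    {k : K} (hv : ∀ p q, p ≠ q → ∃ h : G.Adj (v p) (v q),
      C.get _ _ h = if MatchedPair p q then k else opp k) :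
    G.IsSpecialFourClique opp C (Finset.univ.image v) := by
  refine ⟨isNClique_four_image fun p q hpq => (hv p q hpq).1, ?_⟩
  obtain ⟨h01, c01⟩ := hv 0 1 (by decide)
  obtain ⟨h23, c23⟩ := hv 2 3 (by decide)
  obtain ⟨h02, c02⟩ := hv 0 2 (by decide)
  obtain ⟨h03, c03⟩ := hv 0 3 (by decide)
  obtain ⟨h12, c12⟩ := hv 1 2 (by decide)
  obtain ⟨h13, c13⟩ := hv 1 3 (by decide)
  rw [if_pos (by decide)] at c01 c23
  rw [if_neg (by decide)] at c02 c03 c12 c13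
  refine ⟨v 0, v 1, v 2, v 3, h01, h23, h02, h03, h12, h13, k, ?_, c01, c23, c02, c03, c12, c13⟩
  ext x
  simp [Fin.exists_fin_succ, eq_comm]

end SimpleGraph

theorem mainTheorem7 :
    ∃ (V : Type) (_ : Finite V) (G : SimpleGraph V),
      (∃ C : G.EdgeLabeling (Fin 6), ¬ ∃ s : Finset V, G.IsMonoFourClique C s) ∧
      (∀ opp : Fin 6 → Fin 6, Function.Involutive opp → (∀ k, opp k ≠ k) →
        ∀ C : G.EdgeLabeling (Fin 6),
          ∃ s : Finset V, G.IsMonoFourClique C s ∨ G.IsSpecialFourClique opp C s) := by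
  classical
  obtain ⟨I, Q, hQ⟩ := exists_partiteSystem_induced_map (Fin 6) (Fin 6)
  refine ⟨Q.V, Q.finite, Q.graph, ⟨Q.labeling, fun ⟨s, hs⟩ =>
    Q.not_isMonoFourClique_labeling s hs⟩, fun opp _ hopp C => ?_⟩
  obtain ⟨φ, hφ⟩ := hQ C
  by_cases hinj : Function.Injective φ
  · have hsurj := Finite.surjective_of_injective hinj
    obtain ⟨k, hk⟩ := hsurj 0
    obtain ⟨l, hl⟩ := hsurj (opp 0)
    have hkl : k ≠ l := by
      rintro rfl
      exact hopp 0 (hl.symm.trans hk)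
    obtain ⟨v, hv⟩ := hφ k l hkl
    refine ⟨Finset.univ.image v, Or.inr (SimpleGraph.isSpecialFourClique_image (k := 0) ?_)⟩
    simpa only [apply_ite φ, hk, hl] using hv
  · obtain ⟨k, l, h, hkl⟩ : ∃ k l, φ k = φ l ∧ k ≠ l := by
      simpa [Function.Injective] using hinj
    obtain ⟨v, hv⟩ := hφ k l hkl
    refine ⟨Finset.univ.image v, Or.inl (SimpleGraph.isMonoFourClique_image (k := φ l) ?_)⟩
    simpa only [apply_ite φ, h, ite_self] using hv
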